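/- Let $(A,A^+,1)$ be an order unit Banach space, i.e. an archimedean partially ordered real vector space with order unit $1$ that is complete in the order unit norm $\|a\|=\inf\{\lambda\ge 0: -\lambda 1\le a\le\lambda 1\}$, and let $E=\{e\in A: 0\le e\le 1\}$. A *compression with focus $p\in E$* is a positive linear map $J:A\to A$ with $J(1)=p$ such that for all $e\in E$: $e\le p$ implies $J(e)=e$, and $J(e)=0$ implies $e\le 1-p$. Let $(J_p)_{p\in P}$ be a *compression base* for $A$: a family of compressions indexed by their foci, where $P\subseteq E$ contains $1$, is closed under $p\mapsto 1-p$ and under sums $p+q\le 1$, and is normal ($d,e,f\in E$, $d+e+f\le 1$ and $d+e,\,d+f\in P$ imply $d\in P$), and where $J_{p+r}\circ J_{q+r}=J_r$ whenever $p,q,r\in P$ and $p+q+r\le 1$. The elements of $P$ are called projections. An element $a\in A$ commutes with $p\in P$ if $a=J_p(a)+J_{1-p}(a)$. For $B\subseteq A$ let $PC(B)$ be the set of all $p\in P$ commuting with every element of $B$, and for $a\in A$ let $P(a)=PC(PC(\{a\})\cup\{a\})$. Assume the *comparability property*: for every $a\in A$ there is $p\in P(a)$ with $J_{1-p}(a)\le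 0\le J_p(a)$. A *JB-product* on $A$ is a commutative bilinear product $\circ$ with identity $1$ such that, for all $a,b\in A$ and with $a^2=a\circ a$, one has $(a^2\circ b)\circ a=a^2\circ(b\circ a)$, $\|a\circ b\|\le\|a\|\,\|b\|$, $\|a^2\|=\|a\|^2$ and $\|a^2\|\le\|a^2+b^2\|$, where $\|\cdot\|$ is the order unit norm. We say that $A$ is a JB-algebra if a JB-product on $A$ exists. For $p\in P$ put $T_p=\tfrac12(I+J_p-J_{1-p})$. Then: 1. $A$ is a JB-algebra if and only if $J_p(q)+J_{1-p}(1-q)=J_q(p)+J_{1-q}(1-p)$ for all $p,q\in P$. 2. $A$ is a JB-algebra if and only if $T_p(q)=T_q(p)$ for all $p,q\in P$. In fact, for each pair $p,q\in P$, the equation $T_p(q)=T_q(p)$ is equivalent to the equation in 1. 3. For every JB-product $\circ$ on $A$, one has $p\circ a=T_p(a)$ for all $p\in P$ and $a\in A$. -/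

import Mathlib

/-- The unit interval `E = {e | 0 ≤ e ≤ 1}` of an ordered vector space with distinguished element
`u` (written `1` in the mathematics). -/
def unitEffects {A : Type*} [Zero A] [PartialOrder A] (u : A) : Set A :=
  {e | 0 ≤ e ∧ e ≤ u}

/-- The order unit norm `inf {t ≥ 0 | -t u ≤ a ≤ t u}`. -/
noncomputable def orderUnitNorm {A : Type*} [AddCommGroup A] [Module ℝ A] [PartialOrder A]
    (u a : A) : ℝ :=
  sInf {t : ℝ | 0 ≤ t ∧ -(t • u) ≤ a ∧ a ≤ t • u}

/-- A partially ordered real vector space `A` is an order unit space with order unit `u`, and its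
norm is the order unit norm. (That the order is translation invariant and invariant under
multiplication by nonnegative scalars is expressed by `IsOrderedAddMonoid` and `PosSMulMono`.) -/
structure IsOrderUnitSpace (A : Type*) [NormedAddCommGroup A] [NormedSpace ℝ A] [PartialOrder A]
    [IsOrderedAddMonoid A] [PosSMulMono ℝ A] (u : A) : Prop where
  unit_nonneg : 0 ≤ u
  exists_le_smul : ∀ a : A, ∃ t : ℝ, a ≤ t • u
  archimedean : ∀ a b : A, (∀ n : ℕ, n • a ≤ b) → a ≤ 0
  norm_eq : ∀ a : A, ‖a‖ = orderUnitNorm u a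

section OrderedVectorSpace

variable {A : Type*} [AddCommGroup A] [Module ℝ A] [PartialOrder A]

/-- `J` is a compression with focus `p`: a positive linear map with image of
`u` equal to `p`, fixing the effects below `p`, and killing only effects below `u - p`. -/
structure IsCompression (u p : A) (J : A →ₗ[ℝ] A) : Prop where
  positive : ∀ a : A, 0 ≤ a → 0 ≤ J a
  map_unit : J u = p
  focus_mem : p ∈ unitEffects u
  map_of_le : ∀ e ∈ unitEffects u, e ≤ p → J e = e
  le_of_map_eq_zero : ∀ e ∈ unitEffects u, J e = 0 → e ≤ u - p

/-- `P` is a normal subalgebra of the effect algebra `E` of all `e` with `0 ≤ e ≤ u`. -/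
structure IsNormalSubalgebra (u : A) (P : Set A) : Prop where
  subset : P ⊆ unitEffects u
  unit_mem : u ∈ P
  compl_mem : ∀ p ∈ P, u - p ∈ P
  add_mem : ∀ p ∈ P, ∀ q ∈ P, p + q ≤ u → p + q ∈ P
  normal : ∀ d ∈ unitEffects u, ∀ e ∈ unitEffects u, ∀ f ∈ unitEffects u,
    d + e + f ≤ u → d + e ∈ P → d + f ∈ P → d ∈ P

/-- `(J p)` for `p ∈ P` is a compression base. The values of `J` outside `P` play no role. -/
structure IsCompressionBase (u : A) (P : Set A) (J : A → A →ₗ[ℝ] A) : Prop where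
  normalSubalgebra : IsNormalSubalgebra u P
  compression : ∀ p ∈ P, IsCompression u p (J p)
  comp_eq : ∀ p ∈ P, ∀ q ∈ P, ∀ r ∈ P, p + q + r ≤ u → (J (p + r)).comp (J (q + r)) = J r

/-- The commutant `C(p)`: the set of all `a` with `a = J_p(a) + J_{1-p}(a)`. -/
def commutantOf (u : A) (J : A → A →ₗ[ℝ] A) (p : A) : Set A :=
  {a | a = J p a + J (u - p) a}

/-- `PC(B)`: the projections commuting with all elements of `B`. -/
def projCommutant (u : A) (P : Set A) (J : A → A →ₗ[ℝ] A) (B : Set A) : Set A :=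
  {p | p ∈ P ∧ ∀ b ∈ B, b ∈ commutantOf u J p}

/-- The P-bicommutant `P(a) = PC(PC(a) ∪ {a})`. -/
def projBicommutant (u : A) (P : Set A) (J : A → A →ₗ[ℝ] A) (a : A) : Set A :=
  projCommutant u P J (projCommutant u P J {a} ∪ {a})

/-- The comparability property: for every `a` there is `p ∈ P(a)` with
`J_{1-p}(a) ≤ 0 ≤ J_p(a)`. -/
def HasComparability (u : A) (P : Set A) (J : A → A →ₗ[ℝ] A) : Prop :=
  ∀ a : A, ∃ p ∈ projBicommutant u P J a, J (u - p) a ≤ 0 ∧ 0 ≤ J p a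

end OrderedVectorSpace

/-- The operator `T_p = (I + J_p - J_{1-p}) / 2`. -/
noncomputable def multOp {A : Type*} [AddCommGroup A] [Module ℝ A] (u : A) (J : A → A →ₗ[ℝ] A)
    (p : A) : A →ₗ[ℝ] A :=
  (2⁻¹ : ℝ) • (LinearMap.id + J p - J (u - p))

/-- The bilinear product `m` makes `A`, with its given norm, a JB-algebra with identity `u`. -/
structure IsJBProduct {A : Type*} [NormedAddCommGroup A] [NormedSpace ℝ A] (u : A)
    (m : A →ₗ[ℝ] A →ₗ[ℝ] A) : Prop where
  complete : CompleteSpace A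
  comm : ∀ a b : A, m a b = m b a
  jordan : ∀ a b : A, m (m (m a a) b) a = m (m a a) (m b a)
  unit_mul : ∀ a : A, m u a = a
  norm_mul_le : ∀ a b : A, ‖m a b‖ ≤ ‖a‖ * ‖b‖
  norm_sq : ∀ a : A, ‖m a a‖ = ‖a‖ ^ 2
  norm_sq_le : ∀ a b : A, ‖m a a‖ ≤ ‖m a a + m b b‖

/-- `A`, with its given norm and the distinguished element `u` as identity, is a JB-algebra for some
product. In an order unit space with order unit `u` and the order unit norm, the cone is
recovered from these data: `0 ≤ a` if and only if `‖‖a‖ • u - a‖ ≤ ‖a‖`. -/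
def IsJBAlgebra (A : Type*) [NormedAddCommGroup A] [NormedSpace ℝ A] (u : A) : Prop :=
  ∃ m : A →ₗ[ℝ] A →ₗ[ℝ] A, IsJBProduct u m

/-! The forward direction shows that a JB-product leaves no choice for multiplication by a
projection. The focus `p` of a compression is idempotent, and the compression must be `x ↦ 2 p(px) -
px`: it fixes the Peirce space of `p` for eigenvalue 1 and kills those for 1/2 and 0
(`compression_apply`). Hence `T_p` is multiplication by `p` (`mul_eq_multOp`), and commutativity of
the product gives `T_p(q) = T_q(p)`.

Conversely, comparability gives a spectral theorem: finite combinations of orthogonal projections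
are dense (`dense_simpleElements`). Symmetry makes `p ↦ T_p` extend linearly to the span of `P`: the
value of `∑ αᵢ T_{pᵢ}` at a projection `q` is `T_q(∑ αᵢ pᵢ)`, so it depends only on the sum. The
same formula bounds the extension, which therefore passes to the completion
(`exists_bilinear_extension`).

The JB axioms are then closed conditions to be tested on simple elements. There squaring just
squares the coefficients, the norm is the largest absolute value of a coefficient, and the Jordan
identity says that multiplications by orthogonal projections commute. The conditions through `J` and
through `T` differ by linear algebra only. -/

/-! ### Compressions on elements bounded by multiples of the focus or of its complement -/

namespace IsCompression

variable {A : Type*} [AddCommGroup A] [Module ℝ A] [PartialOrder A] {u p : A} {J : A →ₗ[ℝ] A}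

theorem mono [IsOrderedAddMonoid A] (h : IsCompression u p J) {a b : A}
    (hab : a ≤ b) : J a ≤ J b := by
  have := h.positive _ (sub_nonneg.2 hab)
  rwa [map_sub, sub_nonneg] at this

theorem map_focus (h : IsCompression u p J) : J p = p := h.map_of_le p h.focus_mem le_rfl

theorem map_compl (h : IsCompression u p J) : J (u - p) = 0 := by
  rw [map_sub, h.map_unit, h.map_focus, sub_self]

theorem map_eq_self [PosSMulMono ℝ A] (h : IsCompression u p J) {x : A} {c : ℝ}
    (hc : 0 ≤ c) (h0 : 0 ≤ x) (hx : x ≤ c • p) : J x = x := by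
  rcases hc.eq_or_lt with rfl | hc
  · rw [zero_smul] at hx
    rw [le_antisymm hx h0, map_zero]
  have h1 : c⁻¹ • x ≤ p := by
    have := smul_le_smul_of_nonneg_left hx (inv_nonneg.2 hc.le)
    rwa [smul_smul, inv_mul_cancel₀ hc.ne', one_smul] at this
  have h2 := h.map_of_le (c⁻¹ • x)
    ⟨smul_nonneg (inv_nonneg.2 hc.le) h0, h1.trans h.focus_mem.2⟩ h1
  rw [map_smul] at h2
  exact smul_right_injective A (inv_ne_zero hc.ne') h2

theorem map_eq_self_of_abs_le [IsOrderedAddMonoid A] [PosSMulMono ℝ A]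
    (h : IsCompression u p J) {x : A} {c : ℝ} (hc : 0 ≤ c)
    (h0 : -(c • p) ≤ x) (hx : x ≤ c • p) : J x = x := by
  have h1 := h.map_eq_self (x := x + c • p) (c := c + c) (add_nonneg hc hc)
    (by rwa [← neg_le_iff_add_nonneg]) (by rw [add_smul]; exact add_le_add_left hx _)
  rwa [map_add, map_smul, h.map_focus, add_left_inj] at h1

theorem map_eq_zero_of_abs_le [IsOrderedAddMonoid A] (h : IsCompression u p J) {x : A} {c : ℝ}
    (h0 : -(c • (u - p)) ≤ x) (hx : x ≤ c • (u - p)) : J x = 0 := by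
  refine le_antisymm ?_ ?_
  · have := h.mono hx
    rwa [map_smul, h.map_compl, smul_zero] at this
  · have := h.mono h0
    rwa [map_neg, map_smul, h.map_compl, smul_zero, neg_zero] at this

end IsCompression

/-! ### Jordan identities and norm estimates for idempotents -/

namespace IsJBProduct

variable {A : Type*} [NormedAddCommGroup A] [NormedSpace ℝ A] {u : A} {m : A →ₗ[ℝ] A →ₗ[ℝ] A}

theorem mul_unit (hm : IsJBProduct u m) (a : A) : m a u = a := by rw [hm.comm, hm.unit_mul]

/-- Square roots of `u - w` for `‖w‖ < 1`, as fixed points of `z ↦ (w + z ∘ z) / 2`. -/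
theorem exists_sq_eq (hm : IsJBProduct u m) {w : A} (hw : ‖w‖ < 1) : ∃ b, m b b = u - w := by
  have := hm.complete
  set s : Set A := Metric.closedBall 0 ‖w‖
  have hs : IsComplete s := Metric.isClosed_closedBall.isComplete
  let f : A → A := fun z => (2⁻¹ : ℝ) • (w + m z z)
  have hmaps : Set.MapsTo f s s := fun z hz => by
    rw [mem_closedBall_zero_iff] at hz ⊢
    rw [norm_smul, Real.norm_of_nonneg (by norm_num : (0 : ℝ) ≤ 2⁻¹)]
    have h1 := norm_add_le w (m z z)
    have h2 := hm.norm_mul_le z z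
    nlinarith [norm_nonneg z, norm_nonneg w]
  have hcontr : ContractingWith ⟨‖w‖, norm_nonneg w⟩ (hmaps.restrict f s s) := by
    refine ⟨hw, LipschitzWith.of_dist_le_mul fun x y => ?_⟩
    obtain ⟨x, hx⟩ := x
    obtain ⟨y, hy⟩ := y
    change dist (f x) (f y) ≤ ‖w‖ * dist x y
    rw [mem_closedBall_zero_iff] at hx hy
    have h1 : f x - f y = (2⁻¹ : ℝ) • m (x + y) (x - y) := by
      simp only [f, map_add, map_sub, LinearMap.add_apply, hm.comm y x, ← smul_sub]
      congr 1
      abel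
    rw [dist_eq_norm, dist_eq_norm, h1, norm_smul,
      Real.norm_of_nonneg (by norm_num : (0 : ℝ) ≤ 2⁻¹)]
    have h2 := hm.norm_mul_le (x + y) (x - y)
    have h3 := norm_add_le x y
    nlinarith [norm_nonneg (x - y)]
  obtain ⟨z, -, hz, -⟩ := hcontr.exists_fixedPoint' hs hmaps
    (x := 0) (Metric.mem_closedBall_self (norm_nonneg w)) (edist_ne_top _ _)
  -- The fixed point satisfies `z² = 2z - w`, which completes the square: `(u - z)² = u - w`.
  refine ⟨u - z, ?_⟩
  have hz' : m z z = (2 : ℝ) • z - w := by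
    have h : (2⁻¹ : ℝ) • (w + m z z) = z := hz
    rw [← h, smul_smul, mul_inv_cancel₀ two_ne_zero, one_smul]
    rw [h]
    abel
  simp only [map_sub, LinearMap.sub_apply, hm.unit_mul, hm.mul_unit, hz']
  module

/-- The linearized Jordan identity. -/
theorem jordan_linearized (hm : IsJBProduct u m) (a b c : A) :
    (2 : ℝ) • m (m (m a c) b) a + m (m (m a a) b) c
      = (2 : ℝ) • m (m a c) (m b a) + m (m a a) (m b c) := by
  -- Half the difference of the identities at `a + c` and `a - c` keeps the terms of odd degree in
  -- `c`; the cubic one is removed by the identity at `c`.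
  have h1 := hm.jordan (a + c) b
  have h2 := hm.jordan (a - c) b
  have h3 := hm.jordan c b
  simp only [map_add, map_sub, LinearMap.add_apply, LinearMap.sub_apply, hm.comm c a] at h1 h2
  linear_combination (norm := module) (2⁻¹ : ℝ) • h1 - (2⁻¹ : ℝ) • h2 - h3

variable {p : A}

/-- Multiplication by `p` is a root of `t(2t - 1)(t - 1)`, so its only possible eigenvalues are 0,
1/2 and 1. -/
theorem peirce (hm : IsJBProduct u m) (hp : m p p = p) (x : A) :
    (2 : ℝ) • m p (m p (m p x)) - (3 : ℝ) • m p (m p x) + m p x = 0 := by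
  have h := hm.jordan_linearized p p x
  rw [hp, hp, hm.comm (m (m p x) p) p, hm.comm (m p x) p] at h
  linear_combination (norm := module) h

theorem corner_sq (hm : IsJBProduct u m) (hp : m p p = p) {x : A} (hx : m p x = x) :
    m p (m x x) = m x x := by
  have h := hm.jordan_linearized p x x
  rw [hp, hx, hm.comm x p, hx, hm.comm _ p] at h
  linear_combination (norm := module) h

theorem norm_idempotent_le (hm : IsJBProduct u m) (hp : m p p = p) : ‖p‖ ≤ 1 := by
  have h := hm.norm_sq p
  rw [hp] at h
  by_contra! h1
  nlinarith

theorem compl_idempotent (hm : IsJBProduct u m) (hp : m p p = p) : m (u - p) (u - p) = u - p := by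
  simp [hm.unit_mul, hm.mul_unit, hp]

/-- Squaring keeps the shape, `(u - p + x)² = u - p + x²`, and squares the norm. The crude bound 2
thus holds for all powers `2 ^ n` of the norm, which forces the norm to be at most 1. -/
theorem norm_compl_add_corner_le (hm : IsJBProduct u m) (hp : m p p = p) {x : A} (hx : m p x = x)
    (h1 : ‖x‖ ≤ 1) : ‖u - p + x‖ ≤ 1 := by
  have hq := hm.compl_idempotent hp
  have key : ∀ n : ℕ, ∀ x : A, m p x = x → ‖x‖ ≤ 1 → ‖u - p + x‖ ^ (2 ^ n) ≤ 2 := by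
    intro n
    induction n with
    | zero =>
      intro x _ h1
      rw [pow_zero, pow_one]
      have h2 := norm_add_le (u - p) x
      have h3 := hm.norm_idempotent_le hq
      linarith
    | succ n ih =>
      intro x hx h1
      have h2 : m (u - p + x) (u - p + x) = u - p + m x x := by
        rw [map_add, map_add, LinearMap.add_apply, LinearMap.add_apply, hq, hm.comm x (u - p)]
        simp [hm.unit_mul, hx]
      rw [pow_succ', pow_mul, ← hm.norm_sq, h2]
      exact ih _ (hm.corner_sq hp hx)
        (by rw [hm.norm_sq]; exact pow_le_one₀ (norm_nonneg x) h1)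
  by_contra! hlt
  obtain ⟨n, hn⟩ := pow_unbounded_of_one_lt 2 hlt
  have h2 := key n x hx h1
  have h3 := pow_le_pow_right₀ hlt.le (Nat.lt_two_pow_self (n := n)).le
  linarith

end IsJBProduct

/-! ### The order unit norm -/

section OrderUnit

variable {A : Type*} [NormedAddCommGroup A] [NormedSpace ℝ A] [PartialOrder A]
  [IsOrderedAddMonoid A] [PosSMulMono ℝ A] {u : A}

namespace IsOrderUnitSpace

theorem smul_unit_mono (hA : IsOrderUnitSpace A u) {s t : ℝ} (h : s ≤ t) : s • u ≤ t • u := by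
  have h1 : 0 ≤ (t - s) • u := smul_nonneg (sub_nonneg.2 h) hA.unit_nonneg
  rwa [sub_smul, sub_nonneg] at h1

theorem norm_le (hA : IsOrderUnitSpace A u) {a : A} {t : ℝ} (ht : 0 ≤ t) (h1 : -(t • u) ≤ a)
    (h2 : a ≤ t • u) : ‖a‖ ≤ t := by
  rw [hA.norm_eq]
  exact csInf_le ⟨0, fun _ h => h.1⟩ ⟨ht, h1, h2⟩

theorem nonpos_of_forall_le_smul (hA : IsOrderUnitSpace A u) {a : A}
    (h : ∀ ε : ℝ, 0 < ε → a ≤ ε • u) : a ≤ 0 := by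
  refine hA.archimedean a u fun n => ?_
  rcases Nat.eq_zero_or_pos n with rfl | hn
  · simpa using hA.unit_nonneg
  have hn' : (0 : ℝ) < n := by exact_mod_cast hn
  have h1 := smul_le_smul_of_nonneg_left (h (n : ℝ)⁻¹ (by positivity)) hn'.le
  rw [smul_smul, mul_inv_cancel₀ hn'.ne', one_smul] at h1
  rwa [← Nat.cast_smul_eq_nsmul ℝ]

/-- By the archimedean property the infimum defining the norm is attained. -/
theorem le_norm_smul (hA : IsOrderUnitSpace A u) (a : A) : a ≤ ‖a‖ • u := by
  rw [← sub_nonpos]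
  refine hA.nonpos_of_forall_le_smul fun ε hε => ?_
  have hne : {t : ℝ | 0 ≤ t ∧ -(t • u) ≤ a ∧ a ≤ t • u}.Nonempty := by
    obtain ⟨s, hs⟩ := hA.exists_le_smul a
    obtain ⟨t, ht⟩ := hA.exists_le_smul (-a)
    refine ⟨max (max s t) 0, le_max_right _ _, ?_, ?_⟩
    · exact neg_le.1 (ht.trans (hA.smul_unit_mono ((le_max_right _ _).trans (le_max_left _ _))))
    · exact hs.trans (hA.smul_unit_mono ((le_max_left _ _).trans (le_max_left _ _)))
  obtain ⟨t, ht, hlt⟩ := exists_lt_of_csInf_lt hne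
    (show sInf _ < ‖a‖ + ε by rw [hA.norm_eq, orderUnitNorm]; linarith)
  rw [sub_le_iff_le_add, ← add_smul]
  exact ht.2.2.trans (hA.smul_unit_mono (by linarith))

theorem neg_norm_smul_le (hA : IsOrderUnitSpace A u) (a : A) : -(‖a‖ • u) ≤ a := by
  have h := hA.le_norm_smul (-a)
  rw [norm_neg] at h
  exact neg_le.1 h

theorem le_smul_of_norm_le (hA : IsOrderUnitSpace A u) {a : A} {t : ℝ} (h : ‖a‖ ≤ t) :
    a ≤ t • u :=
  (hA.le_norm_smul a).trans (hA.smul_unit_mono h)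

theorem norm_unit_le (hA : IsOrderUnitSpace A u) : ‖u‖ ≤ 1 :=
  hA.norm_le zero_le_one (by simpa using (neg_nonpos.2 hA.unit_nonneg).trans hA.unit_nonneg)
    (by simp)

theorem norm_le_of_nonneg_of_le (hA : IsOrderUnitSpace A u) {a b : A} (ha : 0 ≤ a) (hab : a ≤ b) :
    ‖a‖ ≤ ‖b‖ :=
  hA.norm_le (norm_nonneg b)
    ((neg_nonpos.2 (smul_nonneg (norm_nonneg b) hA.unit_nonneg)).trans ha)
    (hab.trans (hA.le_norm_smul b))

theorem isClosed_nonneg (hA : IsOrderUnitSpace A u) : IsClosed {a : A | 0 ≤ a} := by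
  rw [← isSeqClosed_iff_isClosed]
  intro x a hx hlim
  rw [Set.mem_ofPred_eq, ← neg_nonpos]
  refine hA.nonpos_of_forall_le_smul fun ε hε => ?_
  obtain ⟨N, hN⟩ := Metric.tendsto_atTop.1 hlim ε hε
  have h1 := hA.le_smul_of_norm_le (t := ε) (a := x N - a)
    (by rw [← dist_eq_norm]; exact (hN N le_rfl).le)
  have h2 : 0 ≤ x N := hx N
  calc -a ≤ x N - a := by rw [sub_eq_add_neg]; exact le_add_of_nonneg_left h2
    _ ≤ ε • u := h1

/-- A positive linear map sending the order unit to an effect is a contraction. -/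
theorem norm_map_le (hA : IsOrderUnitSpace A u) {J : A →ₗ[ℝ] A} (hJ : ∀ a, 0 ≤ a → 0 ≤ J a)
    (hu : J u ≤ u) (a : A) : ‖J a‖ ≤ ‖a‖ := by
  have key : ∀ b : A, J b ≤ ‖b‖ • u := fun b => by
    have h := hJ _ (sub_nonneg.2 (hA.le_norm_smul b))
    rw [map_sub, map_smul, sub_nonneg] at h
    exact h.trans (smul_le_smul_of_nonneg_left hu (norm_nonneg b))
  refine hA.norm_le (norm_nonneg a) ?_ (key a)
  have := key (-a)
  rw [map_neg, norm_neg] at this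
  exact neg_le.1 this

end IsOrderUnitSpace

theorem IsCompression.norm_map_le {p : A} {J : A →ₗ[ℝ] A} (h : IsCompression u p J)
    (hA : IsOrderUnitSpace A u) (a : A) : ‖J a‖ ≤ ‖a‖ :=
  hA.norm_map_le h.positive (h.map_unit.trans_le h.focus_mem.2) a

/-! ### Compressions in a JB-algebra are determined by their foci -/

namespace IsJBProduct

variable {m : A →ₗ[ℝ] A →ₗ[ℝ] A}

/-- For `‖a‖ < 1` write `u - a² = b²`. Then `‖b²‖ ≤ ‖b² + a²‖ = ‖u‖ ≤ 1`, so `u - a² ≤ u`. -/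
theorem sq_nonneg (hm : IsJBProduct u m) (hA : IsOrderUnitSpace A u) (a : A) : 0 ≤ m a a := by
  have key : ∀ a : A, ‖a‖ < 1 → 0 ≤ m a a := fun a ha => by
    obtain ⟨b, hb⟩ := hm.exists_sq_eq (w := m a a)
      (by rw [hm.norm_sq]; exact pow_lt_one₀ (norm_nonneg a) ha two_ne_zero)
    have h1 := hm.norm_sq_le b a
    rw [hb, sub_add_cancel] at h1
    have h2 := hA.le_smul_of_norm_le (h1.trans hA.norm_unit_le)
    rwa [one_smul, sub_le_self_iff] at h2
  have hpos : 0 < ‖a‖ + 1 := by positivity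
  have h1 := key ((‖a‖ + 1)⁻¹ • a) (by
    rw [norm_smul, norm_inv, Real.norm_of_nonneg hpos.le, inv_mul_lt_iff₀ hpos]
    linarith)
  have h2 := smul_nonneg (mul_self_nonneg (‖a‖ + 1)) h1
  simp only [map_smul, LinearMap.smul_apply, smul_smul] at h2
  convert h2 using 1
  field_simp
  simp

theorem mul_self_le (hm : IsJBProduct u m) (hA : IsOrderUnitSpace A u) {p : A}
    (hp : p ∈ unitEffects u) : m p p ≤ p := by
  have hs : ‖(2 : ℝ) • p - u‖ ≤ 1 := by
    refine hA.norm_le zero_le_one ?_ ?_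
    · rw [one_smul, neg_le_sub_iff_le_add]
      exact le_add_of_nonneg_left (smul_nonneg zero_le_two hp.1)
    · rw [one_smul, sub_le_iff_le_add, two_smul]
      exact add_le_add hp.2 hp.2
  have h1 := hA.le_smul_of_norm_le (t := 1) (a := m ((2 : ℝ) • p - u) ((2 : ℝ) • p - u))
    (by rw [hm.norm_sq]; exact pow_le_one₀ (norm_nonneg _) hs)
  have h2 : (1 : ℝ) • u - m ((2 : ℝ) • p - u) ((2 : ℝ) • p - u) = (4 : ℝ) • (p - m p p) := by
    simp only [map_sub, LinearMap.sub_apply, map_smul, LinearMap.smul_apply, hm.unit_mul,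
      hm.mul_unit]
    module
  rw [← sub_nonneg, h2] at h1
  have h3 := smul_nonneg (by norm_num : (0 : ℝ) ≤ 4⁻¹) h1
  rwa [smul_smul, inv_mul_cancel₀ (by norm_num), one_smul, sub_nonneg] at h3

/-- The effect `p - p²` lies below both `p` and `u - p`: the compression fixes it by the first bound
and kills it by the second. -/
theorem focus_idempotent (hm : IsJBProduct u m) (hA : IsOrderUnitSpace A u) {p : A}
    {J : A →ₗ[ℝ] A} (hJ : IsCompression u p J) : m p p = p := by
  have h0 : 0 ≤ p - m p p := sub_nonneg.2 (hm.mul_self_le hA hJ.focus_mem)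
  have h1 : p - m p p ≤ p := sub_le_self _ (hm.sq_nonneg hA p)
  have h2 : p - m p p ≤ u - p := by
    have := hm.sq_nonneg hA (u - p)
    rw [← sub_nonneg]
    convert this using 1
    simp only [map_sub, LinearMap.sub_apply, hm.unit_mul, hm.mul_unit]
  have h3 := hJ.mono h2
  rw [hJ.map_of_le _ ⟨h0, h1.trans hJ.focus_mem.2⟩ h1, hJ.map_compl] at h3
  exact (sub_eq_zero.1 (le_antisymm h3 h0)).symm

variable {p : A}

/-- With `b = x / ‖x‖`, the element `u - p + (p - b)/2` has norm at most 1, hence lies below `u`;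
this says `-p ≤ b`. -/
theorem neg_le_corner (hm : IsJBProduct u m) (hA : IsOrderUnitSpace A u) (hp : m p p = p) {x : A}
    (hx : m p x = x) : -(‖x‖ • p) ≤ x := by
  rcases eq_or_ne x 0 with rfl | hx0
  · simp
  have hn : 0 < ‖x‖ := norm_pos_iff.2 hx0
  set b := ‖x‖⁻¹ • x with hb
  have hb1 : ‖b‖ ≤ 1 := by rw [hb, norm_smul, norm_inv, norm_norm, inv_mul_cancel₀ hn.ne']
  have hbp : m p b = b := by rw [hb, map_smul, hx]
  have h1 := hm.norm_compl_add_corner_le hp (x := (2⁻¹ : ℝ) • (p - b))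
    (by rw [map_smul, map_sub, hp, hbp]) (by
      rw [norm_smul, Real.norm_of_nonneg (by norm_num : (0 : ℝ) ≤ 2⁻¹)]
      have := norm_sub_le p b
      have := hm.norm_idempotent_le hp
      linarith)
  have h2 := hA.le_smul_of_norm_le h1
  rw [← sub_nonneg] at h2
  have h3 := smul_nonneg (mul_nonneg zero_le_two hn.le) h2
  rw [← sub_nonneg]
  convert h3 using 1
  have h4 : x = ‖x‖ • b := by rw [hb, smul_smul, mul_inv_cancel₀ hn.ne', one_smul]
  rw [sub_neg_eq_add]
  nth_rewrite 1 [h4]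
  module

theorem corner_le (hm : IsJBProduct u m) (hA : IsOrderUnitSpace A u) (hp : m p p = p) {x : A}
    (hx : m p x = x) : x ≤ ‖x‖ • p := by
  have h := hm.neg_le_corner hA hp (x := -x) (by rw [map_neg, hx])
  rwa [norm_neg, neg_le_neg_iff] at h

/-- A compression annihilates the half Peirce space of its focus. -/
theorem map_half_eq_zero (hm : IsJBProduct u m) (hA : IsOrderUnitSpace A u) {J : A →ₗ[ℝ] A}
    (hJ : IsCompression u p J) {a : A} (ha : m p a = (2⁻¹ : ℝ) • a) : J a = 0 := by
  have hp := hm.focus_idempotent hA hJ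
  -- Apply `J` to the square of `u - p + t a`. The constant term dies, and for small `t` of either
  -- sign the linear term would beat the quadratic one unless `J a = 0`.
  have key : ∀ t : ℝ, 0 ≤ t • J a + (t * t) • J (m a a) := fun t => by
    have h1 : m (u - p + t • a) (u - p + t • a) = u - p + t • a + (t * t) • m a a := by
      rw [map_add, map_add, LinearMap.add_apply, LinearMap.add_apply, hm.compl_idempotent hp,
        hm.comm (t • a) (u - p)]
      simp only [map_sub, map_smul, LinearMap.sub_apply, LinearMap.smul_apply, hm.unit_mul, ha]
      module
    have h2 := hJ.positive _ (hm.sq_nonneg hA (u - p + t • a))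
    rwa [h1, map_add, map_add, hJ.map_compl, zero_add, map_smul, map_smul] at h2
  have key2 : ∀ σ : ℝ, σ * σ = 1 → σ • J a ≤ 0 := fun σ hσ => by
    refine hA.nonpos_of_forall_le_smul fun ε hε => ?_
    set N := ‖J (m a a)‖ + 1
    have hN : 0 < N := by positivity
    have h1 := key (-(σ * (ε / N)))
    have h2 := hA.le_smul_of_norm_le (show ‖J (m a a)‖ ≤ N by simp [N])
    have h3 := smul_nonneg (by positivity : 0 ≤ N / ε) h1
    have h4 := smul_le_smul_of_nonneg_left h2 (by positivity : 0 ≤ ε / N)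
    have h5 : (N / ε) • (-(σ * (ε / N)) • J a + (-(σ * (ε / N)) * -(σ * (ε / N))) • J (m a a))
        = (ε / N) • J (m a a) - σ • J a := by
      have e1 : N / ε * -(σ * (ε / N)) = -σ := by field_simp
      have e2 : N / ε * (-(σ * (ε / N)) * -(σ * (ε / N))) = ε / N := by
        field_simp
        linear_combination hσ
      rw [smul_add, smul_smul, smul_smul, e1, e2, neg_smul]
      abel
    rw [h5, sub_nonneg] at h3
    refine (h3.trans h4).trans_eq ?_
    rw [smul_smul, div_mul_cancel₀ _ hN.ne']
  refine le_antisymm (by simpa using key2 1 (by norm_num)) ?_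
  simpa using key2 (-1) (by norm_num)

theorem compression_apply (hm : IsJBProduct u m) (hA : IsOrderUnitSpace A u) {J : A →ₗ[ℝ] A}
    (hJ : IsCompression u p J) (x : A) : J x = (2 : ℝ) • m p (m p x) - m p x := by
  have hp := hm.focus_idempotent hA hJ
  have hq := hm.compl_idempotent hp
  have hP := hm.peirce hp x
  -- Peirce components of `x` for the eigenvalues 1, 1/2 and 0, read off by Lagrange interpolation.
  set x₁ := (2 : ℝ) • m p (m p x) - m p x with h₁
  set x₂ := (4 : ℝ) • (m p x - m p (m p x)) with h₂
  set x₀ := x - (3 : ℝ) • m p x + (2 : ℝ) • m p (m p x) with h₀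
  have hx : x = x₁ + x₂ + x₀ := by rw [h₁, h₂, h₀]; module
  have e1 : m p x₁ = x₁ := by
    simp only [h₁, map_sub, map_smul]
    linear_combination (norm := module) hP
  have e2 : m p x₂ = (2⁻¹ : ℝ) • x₂ := by
    simp only [h₂, map_sub, map_smul]
    linear_combination (norm := module) (-2 : ℝ) • hP
  have e0 : m (u - p) x₀ = x₀ := by
    simp only [h₀, map_sub, map_add, LinearMap.sub_apply, hm.unit_mul, map_smul]
    linear_combination (norm := module) -hP
  rw [hx, map_add, map_add,
    hJ.map_eq_self_of_abs_le (norm_nonneg _) (hm.neg_le_corner hA hp e1) (hm.corner_le hA hp e1),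
    hm.map_half_eq_zero hA hJ e2,
    hJ.map_eq_zero_of_abs_le (hm.neg_le_corner hA hq e0) (hm.corner_le hA hq e0), add_zero,
    add_zero]

theorem mul_eq_multOp (hm : IsJBProduct u m) (hA : IsOrderUnitSpace A u) {P : Set A}
    {J : A → A →ₗ[ℝ] A} (hJ : IsCompressionBase u P J) {p : A} (hp : p ∈ P) (a : A) :
    m p a = multOp u J p a := by
  have h1 := hm.compression_apply hA (hJ.compression p hp) a
  have h2 := hm.compression_apply hA
    (hJ.compression (u - p) (hJ.normalSubalgebra.compl_mem p hp)) a
  simp only [map_sub, LinearMap.sub_apply, hm.unit_mul] at h2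
  simp only [multOp, LinearMap.smul_apply, LinearMap.sub_apply, LinearMap.add_apply,
    LinearMap.id_apply, h1, h2]
  module

end IsJBProduct

end OrderUnit

/-! ### Commuting projections and spectral partitions -/

namespace IsCompressionBase

theorem mem_commutantOf_compl {A : Type*} [AddCommGroup A] [Module ℝ A] {u : A}
    {J : A → A →ₗ[ℝ] A} {p a : A} :
    a ∈ commutantOf u J (u - p) ↔ a ∈ commutantOf u J p := by
  simp only [commutantOf, Set.mem_ofPred_eq, sub_sub_cancel, add_comm]

section Order

variable {A : Type*} [AddCommGroup A] [Module ℝ A] [PartialOrder A] {u : A} {P : Set A}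
  {J : A → A →ₗ[ℝ] A}

theorem compl_mem (h : IsCompressionBase u P J) {p : A} (hp : p ∈ P) : u - p ∈ P :=
  h.normalSubalgebra.compl_mem p hp

theorem unit_mem (h : IsCompressionBase u P J) : u ∈ P := h.normalSubalgebra.unit_mem

theorem zero_mem (h : IsCompressionBase u P J) : (0 : A) ∈ P := by
  simpa using h.compl_mem h.unit_mem

theorem nonneg (h : IsCompressionBase u P J) {p : A} (hp : p ∈ P) : 0 ≤ p :=
  (h.normalSubalgebra.subset hp).1

theorem le_unit (h : IsCompressionBase u P J) {p : A} (hp : p ∈ P) : p ≤ u :=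
  (h.normalSubalgebra.subset hp).2

theorem mem_commutantOf_sub_smul (h : IsCompressionBase u P J) {p a : A} (hp : p ∈ P) (t : ℝ) :
    a - t • u ∈ commutantOf u J p ↔ a ∈ commutantOf u J p := by
  have e : t • u = t • p + t • (u - p) := by rw [← smul_add, add_sub_cancel]
  simp only [commutantOf, Set.mem_ofPred_eq, map_sub, map_smul, (h.compression p hp).map_unit,
    (h.compression _ (h.compl_mem hp)).map_unit]
  rw [sub_add_sub_comm, ← e, sub_left_inj]

theorem unit_sub_mem_commutantOf (h : IsCompressionBase u P J) {p a : A} (hp : p ∈ P)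
    (ha : a ∈ commutantOf u J p) : u - a ∈ commutantOf u J p := by
  simp only [commutantOf, Set.mem_ofPred_eq, map_sub, (h.compression p hp).map_unit,
    (h.compression _ (h.compl_mem hp)).map_unit] at ha ⊢
  nth_rewrite 1 [ha]
  abel

variable [IsOrderedAddMonoid A]

theorem sub_mem (h : IsCompressionBase u P J) {p q : A} (hp : p ∈ P) (hq : q ∈ P) (hpq : p ≤ q) :
    q - p ∈ P := by
  have h1 := h.normalSubalgebra.add_mem p hp (u - q) (h.compl_mem hq)
    (by rw [add_sub_left_comm, add_le_iff_nonpos_right, sub_nonpos]; exact hpq)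
  have h2 := h.compl_mem h1
  rwa [show u - (p + (u - q)) = q - p by abel] at h2

theorem map_mem (h : IsCompressionBase u P J) {p q : A} (hp : p ∈ P) (hq : q ∈ P) :
    0 ≤ J p q ∧ J p q ≤ p := by
  have hc := h.compression p hp
  exact ⟨hc.positive q (h.nonneg hq), (hc.mono (h.le_unit hq)).trans_eq hc.map_unit⟩

theorem comp_of_le (h : IsCompressionBase u P J) {p q : A} (hp : p ∈ P) (hq : q ∈ P) (hpq : p ≤ q)
    (x : A) : J p (J q x) = J p x ∧ J q (J p x) = J p x := by
  have hs := h.sub_mem hp hq hpq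
  have hle : q - p + p ≤ u := by rw [sub_add_cancel]; exact h.le_unit hq
  have h1 := h.comp_eq 0 h.zero_mem (q - p) hs p hp (by rwa [zero_add])
  have h2 := h.comp_eq (q - p) hs 0 h.zero_mem p hp (by rwa [add_zero])
  rw [zero_add, sub_add_cancel] at h1 h2
  exact ⟨LinearMap.congr_fun h1 x, LinearMap.congr_fun h2 x⟩

/-- The meet of two commuting projections is a projection, and its compression is the composite. -/
theorem meet (h : IsCompressionBase u P J) {p q : A} (hp : p ∈ P) (hq : q ∈ P)
    (hc : q ∈ commutantOf u J p) :
    J p q ∈ P ∧ J p q ≤ q ∧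
      ∀ x, J p (J q x) = J (J p q) x ∧ J q (J p x) = J (J p q) x := by
  have hp' := h.compl_mem hp
  have hc' : q = J p q + J (u - p) q := hc
  set d := J p q with hd
  have hd0 := h.map_mem hp hq
  have he0 := h.map_mem hp' hq
  have he : q - d = J (u - p) q := by rw [sub_eq_iff_eq_add']; exact hc'
  have hdq : d ≤ q := by rw [← sub_nonneg, he]; exact he0.1
  have hsum : (p - d) + (q - d) + d ≤ u := by
    rw [he, add_right_comm, sub_add_cancel, ← le_sub_iff_add_le']
    exact he0.2
  have hdP : d ∈ P := by
    -- Normality applies to `d`, `q - d`, `p - d`: their sum is `p + J (u - p) q`, which is at most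
    -- `u`.
    refine h.normalSubalgebra.normal d ⟨hd0.1, hd0.2.trans (h.le_unit hp)⟩ (q - d)
      ⟨sub_nonneg.2 hdq, (sub_le_self _ hd0.1).trans (h.le_unit hq)⟩ (p - d)
      ⟨sub_nonneg.2 hd0.2, (sub_le_self _ hd0.1).trans (h.le_unit hp)⟩ ?_ ?_ ?_
    · exact (by abel : d + (q - d) + (p - d) = (p - d) + (q - d) + d).trans_le hsum
    · rwa [add_sub_cancel]
    · rwa [add_sub_cancel]
  have hsum' : (q - d) + (p - d) + d ≤ u := by rwa [add_comm (q - d)]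
  have h1 := h.comp_eq (p - d) (h.sub_mem hdP hp hd0.2) (q - d) (h.sub_mem hdP hq hdq) d hdP hsum
  have h2 := h.comp_eq (q - d) (h.sub_mem hdP hq hdq) (p - d) (h.sub_mem hdP hp hd0.2) d hdP hsum'
  rw [sub_add_cancel, sub_add_cancel] at h1 h2
  exact ⟨hdP, hdq, fun x => ⟨LinearMap.congr_fun h1 x, LinearMap.congr_fun h2 x⟩⟩

end Order

variable {A : Type*} [NormedAddCommGroup A] [NormedSpace ℝ A] [PartialOrder A]
  [IsOrderedAddMonoid A] [PosSMulMono ℝ A] {u : A} {P : Set A} {J : A → A →ₗ[ℝ] A}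

theorem map_unit_apply (h : IsCompressionBase u P J) (hA : IsOrderUnitSpace A u) (x : A) :
    J u x = x :=
  (h.compression u h.unit_mem).map_eq_self_of_abs_le (norm_nonneg x) (hA.neg_norm_smul_le x)
    (hA.le_norm_smul x)

theorem map_zero_apply (h : IsCompressionBase u P J) (hA : IsOrderUnitSpace A u) (x : A) :
    J 0 x = 0 :=
  (h.compression 0 h.zero_mem).map_eq_zero_of_abs_le (c := ‖x‖)
    (by simpa using hA.neg_norm_smul_le x) (by simpa using hA.le_norm_smul x)

theorem comp_of_orthogonal (h : IsCompressionBase u P J) (hA : IsOrderUnitSpace A u) {p q : A}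
    (hp : p ∈ P) (hq : q ∈ P) (hpq : p + q ≤ u) (x : A) : J p (J q x) = 0 := by
  have h1 := h.comp_eq p hp q hq 0 h.zero_mem (by rwa [add_zero])
  rw [add_zero, add_zero] at h1
  exact (LinearMap.congr_fun h1 x).trans (h.map_zero_apply hA x)

/-- The projections commuting with `a` are closed under meets of commuting pairs. -/
theorem meet_mem_projCommutant (h : IsCompressionBase u P J) (hA : IsOrderUnitSpace A u)
    {a p d : A} (hp : p ∈ P) (hpa : a ∈ commutantOf u J p) (hd : d ∈ P)
    (hda : a ∈ commutantOf u J d) (hc : d ∈ commutantOf u J p) :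
    a ∈ commutantOf u J (J p d) := by
  have hp' := h.compl_mem hp
  have hd' := h.compl_mem hd
  have hcc := h.unit_sub_mem_commutantOf hp hc
  obtain ⟨hx, hxd, hJx⟩ := h.meet hp hd hc
  obtain ⟨hy, -, hJy⟩ := h.meet hp' hd (mem_commutantOf_compl.2 hc)
  obtain ⟨hz, hzd, hJz⟩ := h.meet hp hd' hcc
  obtain ⟨hw, hwd, hJw⟩ := h.meet hp' hd' (mem_commutantOf_compl.2 hcc)
  have hxp := (h.map_mem hp hd).2
  have hyp := (h.map_mem hp' hd).2
  simp only [commutantOf, Set.mem_ofPred_eq] at hpa hda ⊢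
  set x := J p d
  set y := J (u - p) d
  set z := J p (u - d)
  set w := J (u - p) (u - d)
  -- Split `a` by `d` and then by `p` into four corners. Those of `y`, `z`, `w` lie below `u - x`,
  -- so compressing to `u - x` removes exactly the corner of `x`.
  have hsum : a = J x a + J y a + J z a + J w a := by
    rw [← (hJx a).1, ← (hJy a).1, ← (hJz a).1, ← (hJw a).1]
    nth_rewrite 1 [hpa]
    nth_rewrite 1 [hda]
    nth_rewrite 3 [hda]
    rw [map_add, map_add]
    abel
  have hx' := h.compl_mem hx
  have hle : ∀ {t s : A}, t ≤ u - s → x ≤ s → t ≤ u - x := fun h1 h2 =>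
    h1.trans (sub_le_sub_left h2 u)
  have h1 : J (u - x) a = J y a + J z a + J w a := by
    nth_rewrite 1 [hsum]
    rw [map_add, map_add, map_add, h.comp_of_orthogonal hA hx' hx (by rw [sub_add_cancel]),
      (h.comp_of_le hy hx' (hle hyp hxp) a).2, (h.comp_of_le hz hx' (hle hzd hxd) a).2,
      (h.comp_of_le hw hx' (hle hwd hxd) a).2, zero_add]
  rw [h1]
  nth_rewrite 1 [hsum]
  abel

open Finset in
/-- Spectral decomposition of `a` below a projection `d` commuting with `a`. -/
theorem exists_spectral_partition (h : IsCompressionBase u P J) (hA : IsOrderUnitSpace A u)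
    (hcomp : HasComparability u P J) (a : A) (ε : ℝ) (n : ℕ) :
    ∀ (d : A) (l : ℝ), d ∈ P → a ∈ commutantOf u J d → l • d ≤ J d a →
      J d a ≤ (l + (n + 1) * ε) • d →
      ∃ p : ℕ → A, (∀ i < n + 1, p i ∈ P) ∧ ∑ i ∈ range (n + 1), p i = d ∧
        ∑ i ∈ range (n + 1), J (p i) a = J d a ∧
        ∀ i < n + 1, (l + i * ε) • p i ≤ J (p i) a ∧ J (p i) a ≤ (l + (i + 1) * ε) • p i := by
  induction n with
  | zero =>
    intro d l hd _ h1 h2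
    refine ⟨fun _ => d, fun _ _ => hd, by simp, by simp, fun i hi => ?_⟩
    obtain rfl : i = 0 := by omega
    simpa using And.intro h1 (by simpa using h2)
  | succ n ih =>
    intro d l hd hda hl hu
    -- Cut at level `l + ε`. Since `d` commutes with `a`, the bicommutant makes `p` commute with `d`
    -- too; the part of `d` under `u - p` is the lowest band, and the rest goes to the induction.
    obtain ⟨p, ⟨hp, hpc⟩, hneg, hpos⟩ := hcomp (a - (l + ε) • u)
    have hp' := h.compl_mem hp
    have hpa : a ∈ commutantOf u J p :=
      (h.mem_commutantOf_sub_smul hp _).1 (hpc _ (Or.inr rfl))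
    have hdp : d ∈ commutantOf u J p := by
      refine hpc d (Or.inl ⟨hd, ?_⟩)
      rintro b rfl
      exact (h.mem_commutantOf_sub_smul hd _).2 hda
    have hdp' := mem_commutantOf_compl.2 hdp
    obtain ⟨h₁P, -, hJ₁⟩ := h.meet hp' hd hdp'
    obtain ⟨h₂P, -, hJ₂⟩ := h.meet hp hd hdp
    have h₂a := h.meet_mem_projCommutant hA hp hpa hd hda hdp
    have hcd := h.compression d hd
    have hcp := h.compression p hp
    have hcp' := h.compression _ hp'
    have hsum : d = J p d + J (u - p) d := hdp
    have hJsum : J d a = J (J p d) a + J (J (u - p) d) a := by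
      rw [← (hJ₂ a).2, ← (hJ₁ a).2, ← map_add]
      exact congrArg _ hpa
    have b1 : l • J (u - p) d ≤ J (J (u - p) d) a := by
      have := hcp'.mono hl
      rwa [(hJ₁ a).1, map_smul] at this
    have b2 : J (J (u - p) d) a ≤ (l + ε) • J (u - p) d := by
      have := hcd.mono hneg
      rwa [(hJ₁ _).2, map_zero, map_sub, map_smul, (h.compression _ h₁P).map_unit,
        sub_nonpos] at this
    have b3 : (l + ε) • J p d ≤ J (J p d) a := by
      have := hcd.positive _ hpos
      rwa [(hJ₂ _).2, map_sub, map_smul, (h.compression _ h₂P).map_unit, sub_nonneg] at this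
    have b4 : J (J p d) a ≤ (l + ε + (n + 1) * ε) • J p d := by
      have := hcp.mono hu
      rw [(hJ₂ a).1, map_smul] at this
      convert this using 2
      push_cast
      ring
    obtain ⟨r, hrP, hrsum, hrJ, hrb⟩ := ih (J p d) (l + ε) h₂P h₂a b3 b4
    refine ⟨fun i => Nat.casesOn i (J (u - p) d) r, ?_, ?_, ?_, ?_⟩
    · rintro (_ | i) hi
      exacts [h₁P, hrP i (by omega)]
    · rw [sum_range_succ']
      exact (congrArg (· + J (u - p) d) hrsum).trans hsum.symm
    · rw [sum_range_succ']
      exact (congrArg (· + J (J (u - p) d) a) hrJ).trans hJsum.symm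
    · rintro (_ | i) hi
      · simpa using And.intro b1 b2
      · have := hrb i (by omega)
        push_cast
        convert this using 3 <;> ring

end IsCompressionBase

/-- A finite orthogonal family of nonzero projections with sum `u`. -/
structure IsProjPartition {A : Type*} [AddCommGroup A] (u : A) (P : Set A) (I : Finset ℕ)
    (p : ℕ → A) : Prop where
  mem : ∀ i ∈ I, p i ∈ P
  ne_zero : ∀ i ∈ I, p i ≠ 0
  sum_eq : ∑ i ∈ I, p i = u

/-- The linear combinations of finite orthogonal families of projections with sum `u`. -/
def simpleElements {A : Type*} [AddCommGroup A] [Module ℝ A] (u : A) (P : Set A) : Set A :=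
  {a | ∃ (I : Finset ℕ) (p : ℕ → A) (α : ℕ → ℝ), IsProjPartition u P I p ∧ a = ∑ i ∈ I, α i • p i}

/-! ### Density of simple elements -/

section

variable {A : Type*} [NormedAddCommGroup A] [NormedSpace ℝ A] [PartialOrder A]
  [IsOrderedAddMonoid A] [PosSMulMono ℝ A] {u : A} {P : Set A} {J : A → A →ₗ[ℝ] A}

open Finset in
theorem dense_simpleElements (h : IsCompressionBase u P J) (hA : IsOrderUnitSpace A u)
    (hcomp : HasComparability u P J) : Dense (simpleElements u P) := by
  classical
  refine Metric.dense_iff.2 fun a r hr => ?_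
  set ε := r / 2
  have hε : 0 < ε := half_pos hr
  -- Enough bands of width `ε` to climb from `-‖a‖` to `‖a‖`.
  obtain ⟨n, hn⟩ := exists_nat_gt (2 * ‖a‖ / ε)
  rw [div_lt_iff₀ hε] at hn
  obtain ⟨p, hpP, hpsum, hpJ, hpb⟩ := h.exists_spectral_partition hA hcomp a ε n u (-‖a‖)
    h.unit_mem (by simp [commutantOf, h.map_unit_apply hA, h.map_zero_apply hA])
    (by rw [h.map_unit_apply hA, neg_smul]; exact hA.neg_norm_smul_le a)
    (by rw [h.map_unit_apply hA]; exact hA.le_smul_of_norm_le (by nlinarith))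
  rw [h.map_unit_apply hA] at hpJ
  set α : ℕ → ℝ := fun i => -‖a‖ + i * ε
  have hI : ∑ i ∈ range (n + 1) with p i ≠ 0, α i • p i = ∑ i ∈ range (n + 1), α i • p i :=
    sum_filter_of_ne fun i _ hi h0 => hi (by rw [h0, smul_zero])
  refine ⟨∑ i ∈ range (n + 1), α i • p i, ?_, {i ∈ range (n + 1) | p i ≠ 0}, p, α, ⟨?_, ?_, ?_⟩,
    hI.symm⟩
  · rw [Metric.mem_ball, dist_comm, dist_eq_norm]
    refine (?_ : _ ≤ ε).trans_lt (half_lt_self hr)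
    have e : a - ∑ i ∈ range (n + 1), α i • p i
        = ∑ i ∈ range (n + 1), (J (p i) a - α i • p i) := by rw [sum_sub_distrib, hpJ]
    rw [e]
    refine hA.norm_le hε.le ((neg_nonpos.2 (smul_nonneg hε.le hA.unit_nonneg)).trans
      (sum_nonneg fun i hi => sub_nonneg.2 (hpb i (mem_range.1 hi)).1)) ?_
    rw [← hpsum, smul_sum]
    refine sum_le_sum fun i hi => ?_
    rw [sub_le_iff_le_add, ← add_smul]
    refine (hpb i (mem_range.1 hi)).2.trans_eq ?_
    congr 1
    simp only [α]
    ring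
  · exact fun i hi => hpP i (mem_range.1 (mem_filter.1 hi).1)
  · exact fun i hi => (mem_filter.1 hi).2
  · rw [sum_filter_ne_zero, hpsum]

end

/-! ### Extending `p ↦ T_p` to a bounded bilinear product -/

open Finset in
/-- The norm of an affine map on a cube is bounded by its norm at the vertices. -/
theorem norm_add_sum_smul_le_of_vertices {E ι : Type*} [NormedAddCommGroup E] [NormedSpace ℝ E]
    {v : ι → E} {C : ℝ} {β : ι → ℝ} (I : Finset ι) (hβ : ∀ i ∈ I, β i ∈ Set.Icc (0 : ℝ) 1) :
    ∀ w : E, (∀ S ⊆ I, ‖w + ∑ i ∈ S, v i‖ ≤ C) → ‖w + ∑ i ∈ I, β i • v i‖ ≤ C := by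
  classical
  induction I using Finset.induction_on with
  | empty => exact fun w hw => by simpa using hw ∅ subset_rfl
  | insert j I hj ih =>
    intro w hw
    rw [sum_insert hj, ← add_assoc]
    refine ih (fun i hi => hβ i (mem_insert_of_mem hi)) _ fun S hS => ?_
    have hjS : j ∉ S := fun h => hj (hS h)
    have h1 := hw S (hS.trans (subset_insert j I))
    have h2 := hw (insert j S) (insert_subset_insert j hS)
    obtain ⟨h3, h4⟩ := hβ j (mem_insert_self j I)
    rw [sum_insert hjS] at h2
    have e : w + β j • v j + ∑ i ∈ S, v i
        = (1 - β j) • (w + ∑ i ∈ S, v i) + β j • (w + (v j + ∑ i ∈ S, v i)) := by module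
    rw [e]
    refine (norm_add_le _ _).trans ?_
    rw [norm_smul, norm_smul, Real.norm_of_nonneg h3, Real.norm_of_nonneg (sub_nonneg.2 h4)]
    nlinarith

open Finset in
-- Rescaling `[-M, M]` to `[0, 1]` by `β = (α / M + 1) / 2` gives `α v = M (2 β v - v)`, whence `M
-- (2C + C)`.
theorem norm_sum_smul_le_of_subsums {E ι : Type*} [NormedAddCommGroup E] [NormedSpace ℝ E]
    {v : ι → E} {C M : ℝ} {α : ι → ℝ} {I : Finset ι} (hα : ∀ i ∈ I, |α i| ≤ M) (hM : 0 ≤ M)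
    (hC : ∀ S ⊆ I, ‖∑ i ∈ S, v i‖ ≤ C) : ‖∑ i ∈ I, α i • v i‖ ≤ 3 * M * C := by
  rcases hM.eq_or_lt with rfl | hM
  · rw [sum_eq_zero fun i hi => by rw [abs_nonpos_iff.1 (hα i hi), zero_smul]]
    simp
  have h1 := norm_add_sum_smul_le_of_vertices (v := v) (C := C)
    (β := fun i => (α i / M + 1) / 2) I
    (fun i hi => by
      have h := abs_le.1 (hα i hi)
      have h2 : -1 ≤ α i / M := by rw [le_div_iff₀ hM]; linarith
      have h3 : α i / M ≤ 1 := by rw [div_le_iff₀ hM]; linarith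
      constructor <;> linarith) 0
    (fun S hS => by simpa using hC S hS)
  have h2 := hC I subset_rfl
  rw [zero_add] at h1
  have e : ∑ i ∈ I, α i • v i
      = M • ((2 : ℝ) • ∑ i ∈ I, ((α i / M + 1) / 2) • v i - ∑ i ∈ I, v i) := by
    rw [smul_sub, smul_smul, smul_sum, smul_sum, ← sum_sub_distrib]
    refine sum_congr rfl fun i _ => ?_
    rw [smul_smul, ← sub_smul]
    congr 1
    field_simp
    ring
  rw [e, norm_smul, Real.norm_of_nonneg hM.le]
  have h3 := norm_sub_le ((2 : ℝ) • ∑ i ∈ I, ((α i / M + 1) / 2) • v i) (∑ i ∈ I, v i)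
  rw [norm_smul, Real.norm_ofNat] at h3
  nlinarith

theorem multOp_apply {A : Type*} [AddCommGroup A] [Module ℝ A] {u : A}
    {J : A → A →ₗ[ℝ] A} (p x : A) : multOp u J p x = (2⁻¹ : ℝ) • (x + J p x - J (u - p) x) := rfl

/-- The graph of the linear extension of `p ↦ T_p` to the span of the projections. -/
def multOpGraph {A : Type*} [NormedAddCommGroup A] [NormedSpace ℝ A] (u : A)
    (P : Set A) (J : A → A →ₗ[ℝ] A) : Submodule ℝ (A × (A →L[ℝ] A)) :=
  Submodule.span ℝ {x | x.1 ∈ P ∧ ∀ y, x.2 y = multOp u J x.1 y}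

/-- This is where symmetry enters: on projections, the operator of a pair in the graph is determined
by its first component. -/
theorem multOpGraph_apply {A : Type*} [NormedAddCommGroup A] [NormedSpace ℝ A] {u : A} {P : Set A}
    {J : A → A →ₗ[ℝ] A}
    (hsymm : ∀ p ∈ P, ∀ q ∈ P, multOp u J p q = multOp u J q p) {x : A × (A →L[ℝ] A)}
    (hx : x ∈ multOpGraph u P J) {q : A} (hq : q ∈ P) : x.2 q = multOp u J q x.1 := by
  induction hx using Submodule.span_induction with
  | mem x hx => rw [hx.2, hsymm _ hx.1 _ hq]
  | zero => simp
  | add x y _ _ hx hy => simp [hx, hy]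
  | smul c x _ hx => simp [hx]

namespace IsProjPartition

open Finset

variable {A : Type*} [AddCommGroup A] [Module ℝ A] [PartialOrder A] [IsOrderedAddMonoid A]
  {u : A} {P : Set A} {J : A → A →ₗ[ℝ] A} {I : Finset ℕ} {p : ℕ → A}

theorem sum_mem (h : IsCompressionBase u P J) (hI : IsProjPartition u P I p) {S : Finset ℕ}
    (hS : S ⊆ I) : ∑ i ∈ S, p i ∈ P := by
  classical
  induction S using Finset.induction_on with
  | empty => simpa using h.zero_mem
  | insert j S hj ih =>
    have h1 := ih ((subset_insert j S).trans hS)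
    have h2 := hI.mem j (hS (mem_insert_self j S))
    have h3 : ∑ i ∈ insert j S, p i ≤ u := by
      rw [← hI.sum_eq]
      exact sum_le_sum_of_subset_of_nonneg hS fun i hi _ => h.nonneg (hI.mem i hi)
    rw [sum_insert hj] at h3 ⊢
    exact h.normalSubalgebra.add_mem _ h2 _ h1 h3

theorem add_le_unit (h : IsCompressionBase u P J) (hI : IsProjPartition u P I p) {i j : ℕ}
    (hi : i ∈ I) (hj : j ∈ I) (hij : i ≠ j) : p i + p j ≤ u := by
  classical
  have hS : ({i, j} : Finset ℕ) ⊆ I := by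
    intro k hk
    rcases mem_insert.1 hk with rfl | hk
    · exact hi
    · rwa [mem_singleton.1 hk]
  have := h.le_unit (hI.sum_mem h hS)
  rwa [sum_pair hij] at this

theorem map_sum_smul (h : IsCompressionBase u P J) (hI : IsProjPartition u P I p) (α : ℕ → ℝ)
    {i : ℕ} (hi : i ∈ I) : J (p i) (∑ j ∈ I, α j • p j) = α i • p i := by
  have hc := h.compression _ (hI.mem i hi)
  rw [map_sum, sum_eq_single_of_mem i hi fun j hj hji => ?_, map_smul, hc.map_focus]
  have h1 := hI.add_le_unit h hi hj hji.symm
  have h0 := h.nonneg (hI.mem j hj)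
  have hle : p j ≤ (1 : ℝ) • (u - p i) := by rwa [one_smul, le_sub_iff_add_le']
  rw [map_smul, hc.map_eq_zero_of_abs_le ((neg_nonpos.2 (h0.trans hle)).trans h0) hle, smul_zero]

end IsProjPartition

theorem IsCompressionBase.multOp_self {A : Type*} [AddCommGroup A] [Module ℝ A] [PartialOrder A]
    {u : A} {P : Set A} {J : A → A →ₗ[ℝ] A} (h : IsCompressionBase u P J) {p : A} (hp : p ∈ P) :
    multOp u J p p = p := by
  have h1 := (h.compression _ (h.compl_mem hp)).map_compl
  rw [sub_sub_cancel] at h1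
  rw [multOp_apply, h1, (h.compression p hp).map_focus, sub_zero, ← two_smul ℝ, smul_smul]
  norm_num

/-- Symmetry of the operators `T_p` restated through the compressions. -/
theorem multOp_symm_iff {A : Type*} [AddCommGroup A] [Module ℝ A] [PartialOrder A] {u : A}
    {P : Set A} {J : A → A →ₗ[ℝ] A} (h : IsCompressionBase u P J) {p q : A}
    (hp : p ∈ P) (hq : q ∈ P) :
    J p q + J (u - p) (u - q) = J q p + J (u - q) (u - p) ↔
      multOp u J p q = multOp u J q p := by
  rw [multOp_apply, multOp_apply, (smul_right_injective A (by norm_num : (2⁻¹ : ℝ) ≠ 0)).eq_iff,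
    map_sub (J (u - p)), map_sub (J (u - q)), (h.compression _ (h.compl_mem hp)).map_unit,
    (h.compression _ (h.compl_mem hq)).map_unit]
  constructor
  · intro e
    linear_combination (norm := module) e
  · intro e
    linear_combination (norm := module) e

section Product

variable {A : Type*} [NormedAddCommGroup A] [NormedSpace ℝ A] [PartialOrder A]
  [IsOrderedAddMonoid A] [PosSMulMono ℝ A] {u : A} {P : Set A} {J : A → A →ₗ[ℝ] A}

namespace IsCompressionBase

theorem norm_multOp_le (h : IsCompressionBase u P J) (hA : IsOrderUnitSpace A u) {p : A}
    (hp : p ∈ P) (x : A) : ‖multOp u J p x‖ ≤ 2 * ‖x‖ := by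
  rw [multOp_apply, norm_smul, Real.norm_of_nonneg (by norm_num : (0 : ℝ) ≤ 2⁻¹)]
  have h1 := norm_sub_le (x + J p x) (J (u - p) x)
  have h2 := norm_add_le x (J p x)
  have h3 := (h.compression p hp).norm_map_le hA x
  have h4 := (h.compression _ (h.compl_mem hp)).norm_map_le hA x
  linarith [norm_nonneg x]

theorem exists_continuous_multOp (h : IsCompressionBase u P J) (hA : IsOrderUnitSpace A u) {p : A}
    (hp : p ∈ P) : ∃ T : A →L[ℝ] A, ∀ x, T x = multOp u J p x :=
  ⟨(multOp u J p).mkContinuous 2 (h.norm_multOp_le hA hp), fun _ => rfl⟩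

theorem multOp_of_orthogonal (h : IsCompressionBase u P J) {p q : A} (hp : p ∈ P) (hq : q ∈ P)
    (hpq : p + q ≤ u) : multOp u J p q = 0 := by
  have h0 := h.nonneg hq
  have hle : q ≤ (1 : ℝ) • (u - p) := by rwa [one_smul, le_sub_iff_add_le']
  have h1 := (h.compression p hp).map_eq_zero_of_abs_le (x := q) (c := 1)
    ((neg_nonpos.2 (h0.trans hle)).trans h0) hle
  have h2 := (h.compression _ (h.compl_mem hp)).map_eq_self zero_le_one h0 hle
  rw [multOp_apply, h1, h2, add_zero, sub_self, smul_zero]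

/-- With `r = u - p - q`, the compressions to `u - p = q + r` and `u - q = p + r` compose to that of
`r` in either order; the other composites collapse by orthogonality or inclusion. -/
theorem multOp_comm_of_orthogonal (h : IsCompressionBase u P J) (hA : IsOrderUnitSpace A u)
    {p q : A} (hp : p ∈ P) (hq : q ∈ P) (hpq : p + q ≤ u) (x : A) :
    multOp u J p (multOp u J q x) = multOp u J q (multOp u J p x) := by
  have hp' := h.compl_mem hp
  have hq' := h.compl_mem hq
  have hqp : q + p ≤ u := by rwa [add_comm]
  have hr := h.compl_mem (h.normalSubalgebra.add_mem p hp q hq hpq)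
  have e1 : q + (u - (p + q)) = u - p := by abel
  have e2 : p + (u - (p + q)) = u - q := by abel
  have hu1 : q + p + (u - (p + q)) ≤ u := by rw [add_comm q p, add_sub_cancel]
  have hu2 : p + q + (u - (p + q)) ≤ u := by rw [add_sub_cancel]
  have c1 := LinearMap.congr_fun (h.comp_eq q hq p hp _ hr hu1) x
  have c2 := LinearMap.congr_fun (h.comp_eq p hp q hq _ hr hu2) x
  rw [e1, e2, LinearMap.comp_apply] at c1 c2
  have o1 := h.comp_of_orthogonal hA hp hq hpq x
  have o2 := h.comp_of_orthogonal hA hq hp hqp x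
  have d1 := h.comp_of_le hp hq' (le_sub_iff_add_le.2 hpq) x
  have d2 := h.comp_of_le hq hp' (le_sub_iff_add_le.2 hqp) x
  simp only [multOp_apply, map_smul, map_add, map_sub, o1, o2, d1.1, d1.2, d2.1, d2.2, c1, c2]
  module

end IsCompressionBase

namespace IsProjPartition

open Finset

variable {I : Finset ℕ} {p : ℕ → A}

theorem abs_coeff_le (h : IsCompressionBase u P J) (hA : IsOrderUnitSpace A u)
    (hI : IsProjPartition u P I p) (α : ℕ → ℝ) {i : ℕ} (hi : i ∈ I) :
    |α i| ≤ ‖∑ j ∈ I, α j • p j‖ := by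
  have hc := h.compression _ (hI.mem i hi)
  have h0 : 0 < ‖p i‖ := norm_pos_iff.2 (hI.ne_zero i hi)
  have h1 := hc.mono (hA.le_norm_smul (p i))
  rw [hc.map_focus, map_smul, hc.map_unit] at h1
  have h2 := hA.norm_le_of_nonneg_of_le (h.nonneg (hI.mem i hi)) h1
  rw [norm_smul, norm_norm] at h2
  have h3 := hc.norm_map_le hA (∑ j ∈ I, α j • p j)
  rw [hI.map_sum_smul h α hi, norm_smul, Real.norm_eq_abs] at h3
  -- From `p i ≤ ‖p i‖ • p i`, obtained by compressing `p i ≤ ‖p i‖ • u`: a nonzero projection has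
  -- norm at least 1.
  have h4 : 1 ≤ ‖p i‖ := by nlinarith
  nlinarith [abs_nonneg (α i)]

theorem norm_sum_smul_le (h : IsCompressionBase u P J) (hA : IsOrderUnitSpace A u)
    (hI : IsProjPartition u P I p) {α : ℕ → ℝ} {C : ℝ} (hC : 0 ≤ C) (hα : ∀ i ∈ I, |α i| ≤ C) :
    ‖∑ j ∈ I, α j • p j‖ ≤ C := by
  have key : ∀ β : ℕ → ℝ, (∀ i ∈ I, |β i| ≤ C) → ∑ j ∈ I, β j • p j ≤ C • u := fun β hβ => by
    rw [← hI.sum_eq, smul_sum]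
    refine sum_le_sum fun i hi => ?_
    have := smul_nonneg (sub_nonneg.2 ((le_abs_self _).trans (hβ i hi))) (h.nonneg (hI.mem i hi))
    rwa [sub_smul, sub_nonneg] at this
  refine hA.norm_le hC ?_ (key α hα)
  have := key (fun i => -α i) (fun i hi => by rw [abs_neg]; exact hα i hi)
  simp only [neg_smul, sum_neg_distrib] at this
  exact neg_le.1 this

end IsProjPartition

open Finset in
-- For simple `b` every subsum of its projections is a projection `q`, where the operator takes the
-- value `T_q x.1` of norm at most `2 ‖x.1‖`. Passing to coefficients costs `3 ‖b‖`, hence the 6.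
theorem norm_multOpGraph_apply_le (h : IsCompressionBase u P J) (hA : IsOrderUnitSpace A u)
    (hcomp : HasComparability u P J)
    (hsymm : ∀ p ∈ P, ∀ q ∈ P, multOp u J p q = multOp u J q p) {x : A × (A →L[ℝ] A)}
    (hx : x ∈ multOpGraph u P J) (b : A) : ‖x.2 b‖ ≤ 6 * ‖x.1‖ * ‖b‖ := by
  have hcl : IsClosed {b | ‖x.2 b‖ ≤ 6 * ‖x.1‖ * ‖b‖} :=
    isClosed_le (by fun_prop) (by fun_prop)
  refine hcl.closure_subset_iff.2 ?_ (dense_simpleElements h hA hcomp b)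
  rintro _ ⟨I, p, α, hI, rfl⟩
  rw [Set.mem_ofPred_eq, map_sum]
  simp only [map_smul]
  refine (norm_sum_smul_le_of_subsums (C := 2 * ‖x.1‖)
    (fun i hi => hI.abs_coeff_le h hA α hi) (norm_nonneg _) fun S hS => ?_).trans_eq (by ring)
  have hS' := hI.sum_mem h hS
  rw [← map_sum, multOpGraph_apply hsymm hx hS']
  exact h.norm_multOp_le hA hS' _

/-- The operators `T_p` extend to a continuous bilinear product. -/
theorem exists_bilinear_extension [CompleteSpace A] (h : IsCompressionBase u P J)
    (hA : IsOrderUnitSpace A u) (hcomp : HasComparability u P J)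
    (hsymm : ∀ p ∈ P, ∀ q ∈ P, multOp u J p q = multOp u J q p) :
    ∃ m : A →L[ℝ] A →L[ℝ] A, ∀ p ∈ P, ∀ x, m p x = multOp u J p x := by
  set G := (multOpGraph u P J).topologicalClosure with hG
  have hbound : ∀ x ∈ G, ‖x.2‖ ≤ 6 * ‖x.1‖ := by
    have hcl : IsClosed {x : A × (A →L[ℝ] A) | ‖x.2‖ ≤ 6 * ‖x.1‖} :=
      isClosed_le (by fun_prop) (by fun_prop)
    exact fun x hx => hcl.closure_subset_iff.2 (fun y hy =>
      y.2.opNorm_le_bound (by positivity) (norm_multOpGraph_apply_le h hA hcomp hsymm hy)) hx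
  let f : G →L[ℝ] A := (ContinuousLinearMap.fst ℝ A (A →L[ℝ] A)).comp G.subtypeL
  have hf : ∀ x : G, f x = x.1.1 := fun _ => rfl
  have : CompleteSpace G := (Submodule.isClosed_topologicalClosure _).completeSpace_coe
  -- The bound makes the first projection of the closed graph bounded below, so its range is closed;
  -- it contains the dense simple elements, and the projection is bijective.
  have hanti : AntilipschitzWith 6 f := f.antilipschitz_of_bound fun x => by
    rw [hf, AddSubgroupClass.coe_norm, Prod.norm_def]
    exact max_le (by norm_num; linarith [norm_nonneg x.1.1]) (hbound _ x.2)
  have hproj : ∀ p ∈ P, ∃ x : G, x.1.1 = p ∧ ∀ y, x.1.2 y = multOp u J p y := fun p hp => by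
    obtain ⟨T, hT⟩ := h.exists_continuous_multOp hA hp
    exact ⟨⟨(p, T), Submodule.le_topologicalClosure _ (Submodule.subset_span ⟨hp, hT⟩)⟩, rfl, hT⟩
  have hsurj : Function.Surjective f := by
    have hcl : IsClosed (Set.range f) := hanti.isClosed_range f.uniformContinuous
    intro a
    refine hcl.closure_subset_iff.2 ?_ (dense_simpleElements h hA hcomp a)
    rintro _ ⟨I, p, α, hI, rfl⟩
    change _ ∈ (LinearMap.range f.toLinearMap : Set A)
    refine Submodule.sum_mem _ fun i hi => Submodule.smul_mem _ _ ?_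
    obtain ⟨x, hx, -⟩ := hproj _ (hI.mem i hi)
    exact ⟨x, hx⟩
  let e : G ≃ₗ[ℝ] A := LinearEquiv.ofBijective f.toLinearMap ⟨hanti.injective, hsurj⟩
  have he : ∀ x : G, e.symm x.1.1 = x := fun x => e.symm_apply_apply x
  let m : A →ₗ[ℝ] A →L[ℝ] A := (LinearMap.snd ℝ A (A →L[ℝ] A)) ∘ₗ G.subtype ∘ₗ e.symm.toLinearMap
  refine ⟨m.mkContinuous 6 fun a => ?_, fun p hp y => ?_⟩
  · have h1 := hbound _ (e.symm a).2
    have h2 : (e.symm a).1.1 = a := e.apply_symm_apply a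
    rwa [h2] at h1
  · obtain ⟨x, rfl, hx⟩ := hproj p hp
    change (e.symm x.1.1).1.2 y = _
    rw [he, hx]

/-! ### The extended product satisfies the JB axioms -/

section Extension

variable {m : A →L[ℝ] A →L[ℝ] A}

theorem extension_comm (h : IsCompressionBase u P J) (hA : IsOrderUnitSpace A u)
    (hcomp : HasComparability u P J)
    (hsymm : ∀ p ∈ P, ∀ q ∈ P, multOp u J p q = multOp u J q p)
    (hm : ∀ p ∈ P, ∀ x, m p x = multOp u J p x) (a b : A) : m a b = m b a := by
  have hd : Dense (Submodule.span ℝ P : Set A) := by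
    refine (dense_simpleElements h hA hcomp).mono ?_
    rintro _ ⟨I, p, α, hI, rfl⟩
    exact Submodule.sum_mem _ fun i hi =>
      Submodule.smul_mem _ _ (Submodule.subset_span (hI.mem i hi))
  have e : m = m.flip := ContinuousLinearMap.ext_on hd fun p hp =>
    ContinuousLinearMap.ext_on hd fun q hq => by
      rw [ContinuousLinearMap.flip_apply, hm p hp, hm q hq, hsymm p hp q hq]
  calc m a b = m.flip a b := by rw [← e]
    _ = m b a := rfl

open Finset in
theorem extension_sq (h : IsCompressionBase u P J)
    (hm : ∀ p ∈ P, ∀ x, m p x = multOp u J p x) {I : Finset ℕ} {p : ℕ → A}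
    (hI : IsProjPartition u P I p) (α : ℕ → ℝ) :
    m (∑ i ∈ I, α i • p i) (∑ i ∈ I, α i • p i) = ∑ i ∈ I, (α i ^ 2) • p i := by
  rw [map_sum m, _root_.sum_apply]
  refine sum_congr rfl fun i hi => ?_
  rw [map_sum, sum_eq_single_of_mem i hi fun j hj hji => ?_]
  · rw [map_smul, map_smul, _root_.smul_apply, hm _ (hI.mem i hi),
      h.multOp_self (hI.mem i hi), smul_smul, sq]
  · rw [map_smul, map_smul, _root_.smul_apply, hm _ (hI.mem i hi),
      h.multOp_of_orthogonal (hI.mem i hi) (hI.mem j hj) (hI.add_le_unit h hi hj hji.symm),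
      smul_zero, smul_zero]

theorem extension_sq_nonneg (h : IsCompressionBase u P J) (hA : IsOrderUnitSpace A u)
    (hcomp : HasComparability u P J) (hm : ∀ p ∈ P, ∀ x, m p x = multOp u J p x) (a : A) :
    0 ≤ m a a := by
  have hcl : IsClosed {a | 0 ≤ m a a} :=
    hA.isClosed_nonneg.preimage (by fun_prop : Continuous fun a => m a a)
  refine hcl.closure_subset_iff.2 ?_ (dense_simpleElements h hA hcomp a)
  rintro _ ⟨I, p, α, hI, rfl⟩
  rw [Set.mem_ofPred_eq, extension_sq h hm hI]
  exact Finset.sum_nonneg fun i hi => smul_nonneg (sq_nonneg _) (h.nonneg (hI.mem i hi))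

theorem extension_norm_sq (h : IsCompressionBase u P J) (hA : IsOrderUnitSpace A u)
    (hcomp : HasComparability u P J) (hm : ∀ p ∈ P, ∀ x, m p x = multOp u J p x) (a : A) :
    ‖m a a‖ = ‖a‖ ^ 2 := by
  have hcl : IsClosed {a | ‖m a a‖ = ‖a‖ ^ 2} := isClosed_eq (by fun_prop) (by fun_prop)
  refine hcl.closure_subset_iff.2 ?_ (dense_simpleElements h hA hcomp a)
  rintro _ ⟨I, p, α, hI, rfl⟩
  rw [Set.mem_ofPred_eq, extension_sq h hm hI]
  -- Both inequalities compare coefficients: the norm of a simple element is the largest `|α i|`.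
  refine le_antisymm ?_ ?_
  · refine hI.norm_sum_smul_le h hA (by positivity) fun i hi => ?_
    rw [abs_pow]
    exact pow_le_pow_left₀ (abs_nonneg _) (hI.abs_coeff_le h hA α hi) 2
  · rw [← Real.le_sqrt (norm_nonneg _) (norm_nonneg _)]
    refine hI.norm_sum_smul_le h hA (Real.sqrt_nonneg _) fun i hi => ?_
    refine Real.le_sqrt_of_sq_le ?_
    rw [← abs_pow]
    exact hI.abs_coeff_le h hA (fun i => α i ^ 2) hi

theorem extension_jordan (h : IsCompressionBase u P J) (hA : IsOrderUnitSpace A u)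
    (hcomp : HasComparability u P J) (hm : ∀ p ∈ P, ∀ x, m p x = multOp u J p x) (a b : A) :
    m a (m (m a a) b) = m (m a a) (m a b) := by
  have hcl : IsClosed {a | m a (m (m a a) b) = m (m a a) (m a b)} :=
    isClosed_eq (by fun_prop) (by fun_prop)
  refine hcl.closure_subset_iff.2 ?_ (dense_simpleElements h hA hcomp a)
  rintro _ ⟨I, p, α, hI, rfl⟩
  rw [Set.mem_ofPred_eq, extension_sq h hm hI]
  have hcomm : ∀ i ∈ I, ∀ j ∈ I, Commute (m (p i)) (m (p j)) := fun i hi j hj => by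
    rcases eq_or_ne i j with rfl | hij
    · exact Commute.refl _
    refine ContinuousLinearMap.ext fun x => ?_
    simp only [mul_apply_eq_comp, hm _ (hI.mem i hi), hm _ (hI.mem j hj)]
    exact h.multOp_comm_of_orthogonal hA (hI.mem i hi) (hI.mem j hj) (hI.add_le_unit h hi hj hij) x
  have hc : Commute (m (∑ i ∈ I, α i • p i)) (m (∑ i ∈ I, (α i ^ 2) • p i)) := by
    simp only [map_sum, map_smul]
    exact Commute.sum_left _ _ _ fun i hi => Commute.sum_right _ _ _ fun j hj =>
      ((hcomm i hi j hj).smul_left _).smul_right _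
  exact congrArg (fun T : A →L[ℝ] A => T b) hc.eq

/-- By polarization, for `a`, `b` in the unit ball the product is a difference of two squares lying
between 0 and `u`. -/
theorem extension_norm_mul_le (h : IsCompressionBase u P J) (hA : IsOrderUnitSpace A u)
    (hcomp : HasComparability u P J)
    (hsymm : ∀ p ∈ P, ∀ q ∈ P, multOp u J p q = multOp u J q p)
    (hm : ∀ p ∈ P, ∀ x, m p x = multOp u J p x) (a b : A) : ‖m a b‖ ≤ ‖a‖ * ‖b‖ := by
  have key : ∀ a b : A, ‖a‖ ≤ 1 → ‖b‖ ≤ 1 → ‖m a b‖ ≤ 1 := fun a b ha hb => by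
    have hsq : ∀ c : A, ‖c‖ ≤ 1 → m c c ≤ (1 : ℝ) • u := fun c hc => hA.le_smul_of_norm_le
      (by rw [extension_norm_sq h hA hcomp hm]; exact pow_le_one₀ (norm_nonneg c) hc)
    have hhalf : ∀ c : A, ‖c‖ ≤ 2 → ‖(2⁻¹ : ℝ) • c‖ ≤ 1 := fun c hc => by
      rw [norm_smul, Real.norm_of_nonneg (by norm_num : (0 : ℝ) ≤ 2⁻¹)]
      linarith
    have h1 := hsq _ (hhalf (a + b) (by linarith [norm_add_le a b]))
    have h2 := hsq _ (hhalf (a - b) (by linarith [norm_sub_le a b]))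
    have h3 := extension_sq_nonneg h hA hcomp hm ((2⁻¹ : ℝ) • (a + b))
    have h4 := extension_sq_nonneg h hA hcomp hm ((2⁻¹ : ℝ) • (a - b))
    have e : m a b = m ((2⁻¹ : ℝ) • (a + b)) ((2⁻¹ : ℝ) • (a + b))
        - m ((2⁻¹ : ℝ) • (a - b)) ((2⁻¹ : ℝ) • (a - b)) := by
      simp only [map_smul, map_add, map_sub, _root_.smul_apply,
        _root_.add_apply, _root_.sub_apply,
        extension_comm h hA hcomp hsymm hm b a]
      module
    rw [e]
    refine hA.norm_le zero_le_one ?_ ((sub_le_self _ h4).trans h1)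
    rw [neg_le_sub_iff_le_add]
    exact h2.trans (le_add_of_nonneg_left h3)
  have hunit : ∀ c : A, ‖‖c‖⁻¹ • c‖ ≤ 1 := fun c => by
    rw [norm_smul, norm_inv, norm_norm]
    exact inv_mul_le_one
  rcases eq_or_ne a 0 with rfl | ha
  · simp
  rcases eq_or_ne b 0 with rfl | hb
  · simp
  have h1 := key (‖a‖⁻¹ • a) (‖b‖⁻¹ • b) (hunit a) (hunit b)
  have ha' := norm_pos_iff.2 ha
  have hb' := norm_pos_iff.2 hb
  rw [map_smul, map_smul, _root_.smul_apply, norm_smul, norm_smul, norm_inv, norm_inv,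
    norm_norm, norm_norm, inv_mul_le_iff₀ hb', mul_one, inv_mul_le_iff₀ ha'] at h1
  exact h1

theorem isJBProduct_extension [CompleteSpace A] (h : IsCompressionBase u P J)
    (hA : IsOrderUnitSpace A u) (hcomp : HasComparability u P J)
    (hsymm : ∀ p ∈ P, ∀ q ∈ P, multOp u J p q = multOp u J q p)
    (hm : ∀ p ∈ P, ∀ x, m p x = multOp u J p x) :
    IsJBProduct u (ContinuousLinearMap.coeLM ℝ ∘ₗ m.toLinearMap) where
  complete := inferInstance
  comm := extension_comm h hA hcomp hsymm hm
  jordan a b := by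
    have hc := extension_comm h hA hcomp hsymm hm
    change m (m (m a a) b) a = m (m a a) (m b a)
    rw [hc _ a, hc b a]
    exact extension_jordan h hA hcomp hm a b
  unit_mul a := by
    change m u a = a
    rw [hm u h.unit_mem, multOp_apply, sub_self, h.map_unit_apply hA, h.map_zero_apply hA]
    module
  norm_mul_le := extension_norm_mul_le h hA hcomp hsymm hm
  norm_sq := extension_norm_sq h hA hcomp hm
  norm_sq_le a b := hA.norm_le_of_nonneg_of_le (extension_sq_nonneg h hA hcomp hm a)
    (le_add_of_nonneg_right (extension_sq_nonneg h hA hcomp hm b))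

end Extension

end Product

theorem theorem5p2 {A : Type*} [NormedAddCommGroup A] [NormedSpace ℝ A] [CompleteSpace A]
    [PartialOrder A] [IsOrderedAddMonoid A] [PosSMulMono ℝ A]
    (u : A) (hA : IsOrderUnitSpace A u)
    (P : Set A) (J : A → A →ₗ[ℝ] A)
    (hJ : IsCompressionBase u P J) (hcomp : HasComparability u P J) :
    (IsJBAlgebra A u ↔
      ∀ p ∈ P, ∀ q ∈ P, J p q + J (u - p) (u - q) = J q p + J (u - q) (u - p)) ∧
    (IsJBAlgebra A u ↔
      ∀ p ∈ P, ∀ q ∈ P, multOp u J p q = multOp u J q p) ∧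
    (∀ p ∈ P, ∀ q ∈ P,
      (J p q + J (u - p) (u - q) = J q p + J (u - q) (u - p) ↔
        multOp u J p q = multOp u J q p)) ∧
    (∀ m : A →ₗ[ℝ] A →ₗ[ℝ] A, IsJBProduct u m →
      ∀ p ∈ P, ∀ a : A, m p a = multOp u J p a) := by
  have hiff : IsJBAlgebra A u ↔ ∀ p ∈ P, ∀ q ∈ P, multOp u J p q = multOp u J q p := by
    constructor
    · rintro ⟨m, hm⟩ p hp q hq
      rw [← hm.mul_eq_multOp hA hJ hp, ← hm.mul_eq_multOp hA hJ hq, hm.comm]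
    · intro hsymm
      obtain ⟨m, hm⟩ := exists_bilinear_extension hJ hA hcomp hsymm
      exact ⟨_, isJBProduct_extension hJ hA hcomp hsymm hm⟩
  refine ⟨?_, hiff, fun p hp q hq => multOp_symm_iff hJ hp hq,
    fun m hm p hp a => hm.mul_eq_multOp hA hJ hp a⟩
  rw [hiff]
  exact forall₄_congr fun p hp q hq => (multOp_symm_iff hJ hp hq).symm
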